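/- Let $q$ be a power of an odd prime, let $r,s\ge 1$, let $R=\mathbb F_q+u\mathbb F_q+v\mathbb F_q+uv\mathbb F_q$ with $u^2=u$, $v^2=v$, $uv=vu$, let $\theta\in\mathrm{Aut}(\mathbb F_q)$, and let $\Theta\in\mathrm{Aut}(R)$ be given by $\Theta(a_0+ua_1+va_2+uva_3)=\theta(a_0)+u\theta(a_1)+v\theta(a_2)+uv\theta(a_3)$. Let $\eta:R\to\mathbb F_q$, $\eta(a_0+ua_1+va_2+uva_3)=a_0$, and regard $\mathbb F_q^r\times R^s$ as an $R$-module by $c\star(\mathbf g,\mathbf b)=(\eta(c)\mathbf g,c\,\mathbf b)$. Let $\mathfrak D\subseteq\mathbb F_q^r\times R^s$ be an $R$-submodule that is $(\theta,\Theta)$-cyclic, i.e. $(g_0,\dots,g_{r-1},b_0,\dots,b_{s-1})\in\mathfrak D$ implies $(\theta(g_{r-1}),\theta(g_0),\dots,\theta(g_{r-2}),\Theta(b_{s-1}),\Theta(b_0),\dots,\Theta(b_{s-2}))\in\mathfrak D$. Let $\mathfrak C_r\subseteq\mathbb F_q^r$ and $\mathfrak C_s\subseteq R^s$ be the images of $\mathfrak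 D$ under the two projections, and suppose that $\mathfrak D$ is separable, i.e. $\mathfrak D=\mathfrak C_r\times\mathfrak C_s$. Suppose that $\mathfrak C_r^\perp\subseteq\mathfrak C_r$ and $\mathfrak C_s^\perp\subseteq\mathfrak C_s$, where $\perp$ denotes the dual for the standard bilinear form $\sum_i x_iy_i$ over $\mathbb F_q$ and over $R$, respectively. Let $\Phi:\mathbb F_q^r\times R^s\to\mathbb F_q^{r+4s}$ be the $\mathbb F_q$-linear Gray map $(g_0,\dots,g_{r-1},b_0,\dots,b_{s-1})\mapsto(g_0,\dots,g_{r-1},b_0M,\dots,b_{s-1}M)$, where for $b=a_0+ua_1+va_2+uva_3$ one puts $bM=(a_0,\;a_0+a_1,\;a_0+a_2,\;a_0+a_1+a_2+a_3)\,M$ and $$M=\tfrac12\begin{pmatrix}1&1&1&1\\1&-1&1&-1\\1&1&-1&-1\\1&-1&-1&1\end{pmatrix}.$$ Let $k$ be the dimension over $\mathbb F_q$ and $d_H$ the minimum Hamming distance of the linear code $\Phi(\mathfrak D)$. Then $2k\ge r+4s$, and there exists a $q$-ary quantum error-correcting code with parameters $[[r+4s,\;2k-(r+4s),\;d_H]]_q$.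 Here an $[[n,\kappa,d]]_q$ quantum code is a subspace $Q\subseteq(\mathbb C^q)^{\otimes n}$ of dimension $q^{\kappa}$ with minimum distance $d$. Let $P$ be the orthogonal projection onto $Q$. An error operator $E=E_1\otimes\dots\otimes E_n$ is detected by $Q$ if $PEP=c_EP$ for some scalar $c_E\in\mathbb C$. If $\kappa\ge1$, the minimum distance of $Q$ is the largest $d$ such that every $E$ with $E_i=I$ for all but fewer than $d$ indices $i$ is detected. If $\kappa=0$, so that every operator is detected, it is by the usual convention the largest $d$ such that every such $E$ satisfies $PEP=q^{-n}\operatorname{tr}(E)\,P$. -/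

import Mathlib

open scoped Matrix

/-- The ring `R = F + uF + vF + uvF` with `u ^ 2 = u`, `v ^ 2 = v`, `uv = vu`. The element
`a₀ + u a₁ + v a₂ + uv a₃` is stored through its four coordinates. -/
@[ext]
structure UVRing (F : Type*) where
  a0 : F
  a1 : F
  a2 : F
  a3 : F

namespace UVRing

section Ring

variable {F : Type*} [CommRing F]

instance : Zero (UVRing F) := ⟨⟨0, 0, 0, 0⟩⟩
instance : One (UVRing F) := ⟨⟨1, 0, 0, 0⟩⟩
instance : Add (UVRing F) :=
  ⟨fun x y => ⟨x.a0 + y.a0, x.a1 + y.a1, x.a2 + y.a2, x.a3 + y.a3⟩⟩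
instance : Neg (UVRing F) := ⟨fun x => ⟨-x.a0, -x.a1, -x.a2, -x.a3⟩⟩
/-- The product of `x₀ + u x₁ + v x₂ + uv x₃` and `y₀ + u y₁ + v y₂ + uv y₃`, expanded with
`u ^ 2 = u`, `v ^ 2 = v` and `uv = vu`. -/
instance : Mul (UVRing F) :=
  ⟨fun x y =>
    ⟨x.a0 * y.a0,
     x.a0 * y.a1 + x.a1 * y.a0 + x.a1 * y.a1,
     x.a0 * y.a2 + x.a2 * y.a0 + x.a2 * y.a2,
     x.a0 * y.a3 + x.a3 * y.a0 + x.a1 * y.a2 + x.a2 * y.a1 + x.a1 * y.a3 + x.a3 * y.a1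
       + x.a2 * y.a3 + x.a3 * y.a2 + x.a3 * y.a3⟩⟩

@[simp] theorem zero_a0 : (0 : UVRing F).a0 = 0 := rfl
@[simp] theorem zero_a1 : (0 : UVRing F).a1 = 0 := rfl
@[simp] theorem zero_a2 : (0 : UVRing F).a2 = 0 := rfl
@[simp] theorem zero_a3 : (0 : UVRing F).a3 = 0 := rfl
@[simp] theorem one_a0 : (1 : UVRing F).a0 = 1 := rfl
@[simp] theorem one_a1 : (1 : UVRing F).a1 = 0 := rfl
@[simp] theorem one_a2 : (1 : UVRing F).a2 = 0 := rfl
@[simp] theorem one_a3 : (1 : UVRing F).a3 = 0 := rfl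
@[simp] theorem add_a0 (x y : UVRing F) : (x + y).a0 = x.a0 + y.a0 := rfl
@[simp] theorem add_a1 (x y : UVRing F) : (x + y).a1 = x.a1 + y.a1 := rfl
@[simp] theorem add_a2 (x y : UVRing F) : (x + y).a2 = x.a2 + y.a2 := rfl
@[simp] theorem add_a3 (x y : UVRing F) : (x + y).a3 = x.a3 + y.a3 := rfl
@[simp] theorem neg_a0 (x : UVRing F) : (-x).a0 = -x.a0 := rfl
@[simp] theorem neg_a1 (x : UVRing F) : (-x).a1 = -x.a1 := rfl
@[simp] theorem neg_a2 (x : UVRing F) : (-x).a2 = -x.a2 := rfl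
@[simp] theorem neg_a3 (x : UVRing F) : (-x).a3 = -x.a3 := rfl
@[simp] theorem mul_a0 (x y : UVRing F) : (x * y).a0 = x.a0 * y.a0 := rfl
@[simp] theorem mul_a1 (x y : UVRing F) :
    (x * y).a1 = x.a0 * y.a1 + x.a1 * y.a0 + x.a1 * y.a1 := rfl
@[simp] theorem mul_a2 (x y : UVRing F) :
    (x * y).a2 = x.a0 * y.a2 + x.a2 * y.a0 + x.a2 * y.a2 := rfl
@[simp] theorem mul_a3 (x y : UVRing F) :
    (x * y).a3 = x.a0 * y.a3 + x.a3 * y.a0 + x.a1 * y.a2 + x.a2 * y.a1 + x.a1 * y.a3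
      + x.a3 * y.a1 + x.a2 * y.a3 + x.a3 * y.a2 + x.a3 * y.a3 := rfl

instance : CommRing (UVRing F) where
  add_assoc x y z := by ext <;> simp <;> ring
  zero_add x := by ext <;> simp
  add_zero x := by ext <;> simp
  add_comm x y := by ext <;> simp <;> ring
  neg_add_cancel x := by ext <;> simp
  mul_assoc x y z := by ext <;> simp <;> ring
  one_mul x := by ext <;> simp
  mul_one x := by ext <;> simp
  left_distrib x y z := by ext <;> simp <;> ring
  right_distrib x y z := by ext <;> simp <;> ring
  zero_mul x := by ext <;> simp
  mul_zero x := by ext <;> simp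
  mul_comm x y := by ext <;> simp <;> ring
  nsmul := nsmulRec
  zsmul := zsmulRec

/-- `R` is an algebra over `F`, with `a` in `F` sent to `a + u 0 + v 0 + uv 0`. -/
instance : Algebra F (UVRing F) :=
  RingHom.toAlgebra
    { toFun := fun a => ⟨a, 0, 0, 0⟩
      map_one' := rfl
      map_mul' := fun a b => by ext <;> simp
      map_zero' := rfl
      map_add' := fun a b => by ext <;> simp }

/-- The element `u`. -/
def u : UVRing F := ⟨0, 1, 0, 0⟩

/-- The element `v`. -/
def v : UVRing F := ⟨0, 0, 1, 0⟩

theorem u_mul_u : (u * u : UVRing F) = u := by ext <;> simp [u]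

theorem v_mul_v : (v * v : UVRing F) = v := by ext <;> simp [v]

theorem eq_sum_coordinates (x : UVRing F) :
    x = algebraMap F _ x.a0 + u * algebraMap F _ x.a1 + v * algebraMap F _ x.a2
      + u * v * algebraMap F _ x.a3 := by
  simp only [RingHom.algebraMap_toAlgebra]
  ext <;> simp [u, v]

/-- The homomorphism `η : R → F`, `a₀ + u a₁ + v a₂ + uv a₃ ↦ a₀`. -/
def eta : UVRing F →+* F where
  toFun x := x.a0
  map_one' := rfl
  map_mul' _ _ := rfl
  map_zero' := rfl
  map_add' _ _ := rfl

/-- `R` acts on `F` through `η`: `r ⋆ g = η(r) g`. With Mathlib's actions on function spaces and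
products this gives the action
`r ⋆ (g, b) = (η(r) g₀, …, η(r) g_{r-1}, r b₀, …, r b_{s-1})` on `F ^ r × R ^ s`. -/
instance : Module (UVRing F) F := Module.compHom F eta

instance : IsScalarTower F (UVRing F) F where
  smul_assoc a x b := by
    have h : (a • x : UVRing F).a0 = a * x.a0 := by
      rw [Algebra.smul_def]; rfl
    change (a • x : UVRing F).a0 * b = a * (x.a0 * b)
    rw [h, mul_assoc]

/-- The automorphism `Θ` of `R` that applies `θ` to the four coordinates. -/
def Theta (θ : F ≃+* F) : UVRing F ≃+* UVRing F where
  toFun x := ⟨θ x.a0, θ x.a1, θ x.a2, θ x.a3⟩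
  invFun x := ⟨θ.symm x.a0, θ.symm x.a1, θ.symm x.a2, θ.symm x.a3⟩
  left_inv x := by ext <;> simp
  right_inv x := by ext <;> simp
  map_mul' x y := by ext <;> simp
  map_add' x y := by ext <;> simp

/-- The vector `(n₁, n₂, n₃, n₄)` with `x = κ₁ n₁ + κ₂ n₂ + κ₃ n₃ + κ₄ n₄`, where
`κ₁ = 1 - u - v + uv`, `κ₂ = u - uv`, `κ₃ = v - uv`, `κ₄ = uv`. -/
def components (x : UVRing F) : Fin 4 → F :=
  ![x.a0, x.a0 + x.a1, x.a0 + x.a2, x.a0 + x.a1 + x.a2 + x.a3]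

/-- The defining property of `components`. -/
theorem eq_sum_components (x : UVRing F) :
    x = components x 0 • (1 - u - v + u * v) + components x 1 • (u - u * v)
      + components x 2 • (v - u * v) + components x 3 • (u * v) := by
  simp only [Algebra.smul_def, RingHom.algebraMap_toAlgebra]
  ext <;> simp [components, u, v, sub_eq_add_neg]
  ring

end Ring

end UVRing

section ClassicalCodes

/-- The Euclidean dual `{y | ∀ x ∈ C, ∑ i, x i * y i = 0}` of a linear code over a commutative
ring. -/
def dualCode {S ι : Type*} [CommRing S] [Fintype ι] (C : Submodule S (ι → S)) :
    Submodule S (ι → S) where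
  carrier := {y | ∀ x ∈ C, x ⬝ᵥ y = 0}
  add_mem' := fun ha hb x hx => by rw [dotProduct_add, ha x hx, hb x hx, add_zero]
  zero_mem' := fun x _ => dotProduct_zero x
  smul_mem' := fun c y hy x hx => by rw [dotProduct_smul, hy x hx, smul_zero]

/-- The Hamming distance of a code: the least Hamming distance of two distinct codewords. -/
noncomputable def codeDistance {A ι : Type*} [DecidableEq A] [Fintype ι] (C : Set (ι → A)) : ℕ :=
  sInf {d | ∃ x ∈ C, ∃ y ∈ C, x ≠ y ∧ hammingDist x y = d}

variable {F : Type*} [Field F] {r s : ℕ}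

/-- The `(θ, Θ)`-cyclic shift `(g₀, …, g_{r-1}, b₀, …, b_{s-1}) ↦
(θ(g_{r-1}), θ(g₀), …, θ(g_{r-2}), Θ(b_{s-1}), Θ(b₀), …, Θ(b_{s-2}))`. -/
def skewShift (θ : F ≃+* F) (d : (Fin r → F) × (Fin s → UVRing F)) :
    (Fin r → F) × (Fin s → UVRing F) :=
  (fun i => θ (d.1 ((finRotate r).symm i)),
   fun i => UVRing.Theta θ (d.2 ((finRotate s).symm i)))

/-- A linear code of block length `(r, s)` (an `R`-submodule of `F ^ r × R ^ s`) is
`(θ, Θ)`-cyclic if it is closed under the `(θ, Θ)`-cyclic shift. -/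
def IsSkewCyclic (θ : F ≃+* F)
    (D : Submodule (UVRing F) ((Fin r → F) × (Fin s → UVRing F))) : Prop :=
  ∀ d ∈ D, skewShift θ d ∈ D

/-- The code `C_r` over `F` obtained from `D` by deleting the last `s` coordinates. -/
def firstCode (D : Submodule (UVRing F) ((Fin r → F) × (Fin s → UVRing F))) :
    Submodule F (Fin r → F) :=
  (D.restrictScalars F).map (LinearMap.fst F (Fin r → F) (Fin s → UVRing F))

/-- The code `C_s` over `R` obtained from `D` by deleting the first `r` coordinates. -/
def secondCode (D : Submodule (UVRing F) ((Fin r → F) × (Fin s → UVRing F))) :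
    Submodule (UVRing F) (Fin s → UVRing F) :=
  D.map (LinearMap.snd (UVRing F) (Fin r → F) (Fin s → UVRing F))

/-- `D` is separable if `D = C_r × C_s`. -/
def IsSeparableCode (D : Submodule (UVRing F) ((Fin r → F) × (Fin s → UVRing F))) : Prop :=
  (D : Set ((Fin r → F) × (Fin s → UVRing F))) =
    (firstCode D : Set (Fin r → F)) ×ˢ (secondCode D : Set (Fin s → UVRing F))

/-- The matrix `M` of the Gray map; `M * Mᵀ = 1` when `2 ≠ 0` in `F`. -/
def grayMatrix (F : Type*) [Field F] : Matrix (Fin 4) (Fin 4) F :=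
  (2 : F)⁻¹ • !![1,  1,  1,  1;
                 1, -1,  1, -1;
                 1,  1, -1, -1;
                 1, -1, -1,  1]

/-- The Gray map `Φ : F ^ r × R ^ s → F ^ (r + 4 s)`,
`(g₀, …, g_{r-1}, b₀, …, b_{s-1}) ↦ (g₀, …, g_{r-1}, b₀ M, …, b_{s-1} M)`, where `b M` is
`(n₁, n₂, n₃, n₄) M` for `b = κ₁ n₁ + κ₂ n₂ + κ₃ n₃ + κ₄ n₄`. -/
def grayMap (F : Type*) [Field F] (r s : ℕ) :
    ((Fin r → F) × (Fin s → UVRing F)) →ₗ[F] (Fin (r + 4 * s) → F) where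
  toFun d := Fin.append d.1 fun j : Fin (4 * s) =>
    (UVRing.components (d.2 ⟨j / 4, by omega⟩) ᵥ* grayMatrix F) ⟨j % 4, by omega⟩
  map_add' d e := by
    have h (x y : UVRing F) :
        UVRing.components (x + y) = UVRing.components x + UVRing.components y := by
      ext i; fin_cases i <;> simp [UVRing.components] <;> ring
    funext i
    refine Fin.addCases (fun i => ?_) (fun i => ?_) i <;> simp [h, Matrix.add_vecMul]
  map_smul' c d := by
    have h (x : UVRing F) : UVRing.components (c • x) = c • UVRing.components x := by
      simp only [Algebra.smul_def, RingHom.algebraMap_toAlgebra]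
      ext i; fin_cases i <;> simp [UVRing.components] <;> ring
    funext i
    refine Fin.addCases (fun i => ?_) (fun i => ?_) i <;> simp [h, Matrix.smul_vecMul]

/-- The Gray image `Φ(D)`, a linear code of length `r + 4 s` over `F`. -/
def grayImage (D : Submodule (UVRing F) ((Fin r → F) × (Fin s → UVRing F))) :
    Submodule F (Fin (r + 4 * s) → F) :=
  (D.restrictScalars F).map (grayMap F r s)

end ClassicalCodes

section QuantumCodes

/-- The Hilbert space `(ℂ ^ q)^{⊗ ι}`, `q = |A|`: it has the orthonormal basis
`|x⟩ = ⨂ i, |x i⟩`, indexed by the words `x : ι → A`. -/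
abbrev QuditSpace (A ι : Type*) : Type _ := EuclideanSpace ℂ (ι → A)

variable {A ι : Type*} [Fintype A] [DecidableEq A] [Fintype ι] [DecidableEq ι]

/-- The matrix of the tensor product `⨂ i, E i` of operators on `ℂ ^ q` in the basis of words. -/
def tensorMatrix (E : ι → Matrix A A ℂ) : Matrix (ι → A) (ι → A) ℂ :=
  Matrix.of fun x y => ∏ i, E i (x i) (y i)

/-- The operator `⨂ i, E i` on `(ℂ ^ q)^{⊗ ι}`. -/
noncomputable def tensorOp (E : ι → Matrix A A ℂ) : QuditSpace A ι →ₗ[ℂ] QuditSpace A ι :=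
  Matrix.toLpLin 2 2 (tensorMatrix E)

/-- The code `Q` detects the error `E` (Knill–Laflamme): `P E P = c P` for a scalar `c`, where `P`
is the orthogonal projection onto `Q`. -/
def DetectsError (Q : Submodule ℂ (QuditSpace A ι)) (E : ι → Matrix A A ℂ) : Prop :=
  ∃ c : ℂ, ∀ x ∈ Q, ∀ y ∈ Q, inner ℂ x (tensorOp E y) = c * inner ℂ x y

/-- The code `Q` is pure for the error `E`: `P E P = c P` with the scalar `c = tr(E) / q ^ n`, the
normalized trace of `E`. -/
def PureForError (Q : Submodule ℂ (QuditSpace A ι)) (E : ι → Matrix A A ℂ) : Prop :=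
  ∀ x ∈ Q, ∀ y ∈ Q, inner ℂ x (tensorOp E y) =
    (tensorMatrix E).trace / (Fintype.card A : ℂ) ^ Fintype.card ι * inner ℂ x y

/-- All errors that act on fewer than `d` of the qudits are detected by `Q`. One-dimensional codes
detect every error, and by the usual convention they are required to be pure for these errors. -/
def QuantumDistanceAtLeast (Q : Submodule ℂ (QuditSpace A ι)) (d : ℕ) : Prop :=
  ∀ T : Finset ι, T.card < d → ∀ E : ι → Matrix A A ℂ, (∀ i ∉ T, E i = 1) →
    DetectsError Q E ∧ (Module.finrank ℂ Q = 1 → PureForError Q E)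

/-- `Q` is an `[[n, k, d]]_q` quantum code, where `n = |ι|` and `q = |A|`: its dimension is `q ^ k`
and its minimum distance is exactly `d`. -/
def IsQuantumCode (Q : Submodule ℂ (QuditSpace A ι)) (n k d : ℕ) : Prop :=
  Fintype.card ι = n ∧ Module.finrank ℂ Q = Fintype.card A ^ k ∧
    IsGreatest {δ | QuantumDistanceAtLeast Q δ} d

end QuantumCodes

/-! The Gray image `C` contains its dual `N`, and the CSS construction applied to `N ≤ C` gives the
quantum code, with one change to make the distance exact.

Inclusion of the dual: `M` is orthogonal, so the Gray map turns the standard forms into a sum of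
componentwise forms. The components identify `R` with `F ^ 4` as a ring, and multiplication by its
idempotents isolates each component. Separability treats the two blocks independently
(`dualCode_grayImage_le`).

Lower bound: the code is spanned by the states of cosets `a + N`, one for each class of `C / N`,
which gives dimension `q ^ (2k - n)`. Errors on fewer than `d` positions cannot connect words at
distance at least `d`, so only diagonal matrix entries survive. As `N` has dual `C`, it is an
orthogonal array of strength `d - 1`, so their sum is the same for every coset. The code is
therefore pure up to `d`, also when `κ = 0`.

Upper bound: a word `w` of weight `d` in `C` gives a phase error acting on each coset state as a
scalar. If the scalars differ, the error is undetected; if `C = N`, purity fails. The usual CSS code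
can have distance above `d` when all words of weight `d` lie in `N`. One coset is then translated by
a vector of weight one, which makes the scalars differ and keeps the cosets `d` apart
(`exists_isQuantumCode_of_dualCode_le`). -/

set_option linter.unusedSectionVars false

/-! ### Coset states, their matrix elements and the distance bounds. -/

section CosetStates

variable {F ι : Type*} [Field F] [Fintype F] [DecidableEq F] [Fintype ι] [DecidableEq ι]

open Classical in
/-- The unnormalized superposition of the words of the coset `a + N`. -/
noncomputable def cosetState (N : Submodule F (ι → F)) (a : ι → F) : QuditSpace F ι :=
  WithLp.toLp 2 fun x => if x - a ∈ N then 1 else 0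

open Classical in
theorem inner_cosetState (N : Submodule F (ι → F)) (E : ι → Matrix F F ℂ) (a b : ι → F) :
    inner ℂ (cosetState N a) (tensorOp E (cosetState N b)) =
      ∑ x, ∑ y, if x - a ∈ N ∧ y - b ∈ N then tensorMatrix E x y else 0 := by
  simp only [tensorOp, Matrix.toLpLin_apply, PiLp.inner_apply, cosetState, Matrix.mulVec,
    dotProduct]
  refine Finset.sum_congr rfl fun x _ => ?_
  by_cases hx : x - a ∈ N <;> simp [hx]

theorem tensorMatrix_one : tensorMatrix (fun _ : ι => (1 : Matrix F F ℂ)) = 1 := by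
  ext x y
  by_cases h : x = y
  · subst h; simp [tensorMatrix]
  · obtain ⟨i, hi⟩ := Function.ne_iff.1 h
    rw [Matrix.one_apply_ne h]
    exact Finset.prod_eq_zero (Finset.mem_univ i) (Matrix.one_apply_ne hi)

theorem tensorOp_one (x : QuditSpace F ι) :
    tensorOp (fun _ : ι => (1 : Matrix F F ℂ)) x = x := by
  simp [tensorOp, tensorMatrix_one]

theorem tensorMatrix_apply_eq_zero {T : Finset ι} {E : ι → Matrix F F ℂ}
    (hE : ∀ i ∉ T, E i = 1) {x y : ι → F} {i : ι} (hi : i ∉ T) (hxy : x i ≠ y i) :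
    tensorMatrix E x y = 0 :=
  Finset.prod_eq_zero (Finset.mem_univ i) (by rw [hE i hi, Matrix.one_apply_ne hxy])

theorem tensorMatrix_diag_congr {T : Finset ι} {E : ι → Matrix F F ℂ}
    (hE : ∀ i ∉ T, E i = 1) {x y : ι → F} (h : ∀ i ∈ T, x i = y i) :
    tensorMatrix E x x = tensorMatrix E y y := by
  refine Finset.prod_congr rfl fun i _ => ?_
  by_cases hi : i ∈ T
  · rw [h i hi]
  · simp [hE i hi]

theorem hammingNorm_le_card {T : Finset ι} {w : ι → F} (h : ∀ i ∉ T, w i = 0) :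
    hammingNorm w ≤ T.card := by
  refine Finset.card_le_card fun i hi => ?_
  by_contra hiT
  exact (Finset.mem_filter.1 hi).2 (h i hiT)

/-- If the dual of `N` has minimum weight at least `d`, then `N` is an orthogonal array of
strength `d - 1`. -/
theorem exists_mem_eqOn {N : Submodule F (ι → F)} {d : ℕ}
    (hN : ∀ w ∈ dualCode N, w ≠ 0 → d ≤ hammingNorm w) {T : Finset ι} (hT : T.card < d)
    (z : ι → F) : ∃ v ∈ N, ∀ i ∈ T, v i = z i := by
  let ρ : (ι → F) →ₗ[F] (T → F) := LinearMap.funLeft F F Subtype.val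
  suffices h : N.map ρ = ⊤ by
    have hz : ρ z ∈ N.map ρ := h ▸ Submodule.mem_top
    obtain ⟨v, hv, hvz⟩ := hz
    exact ⟨v, hv, fun i hi => congrFun hvz ⟨i, hi⟩⟩
  by_contra hne
  obtain ⟨f, hf, hle⟩ := Submodule.exists_le_ker_of_lt_top _ (lt_top_iff_ne_top.2 hne)
  -- A functional that kills the projection of `N` to `T`, extended by zero, is a dual word
  -- supported in `T`: too light to be nonzero.
  let w : ι → F := fun i => if h : i ∈ T then f (Pi.single ⟨i, h⟩ 1) else 0
  have hfw (v : ι → F) : v ⬝ᵥ w = f (ρ v) := by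
    have h1 : v ⬝ᵥ w = ∑ i ∈ T, v i * w i :=
      (Finset.sum_subset (Finset.subset_univ T) fun i _ hi => by simp [w, hi]).symm
    rw [h1, ← Finset.sum_coe_sort, LinearMap.pi_apply_eq_sum_univ f (ρ v)]
    refine Finset.sum_congr rfl fun i _ => ?_
    have : (fun j : T => if i = j then (1 : F) else 0) = Pi.single i 1 := by
      ext j; simp [Pi.single_apply, eq_comm]
    simp [w, this, ρ, LinearMap.funLeft_apply]
  have hw : w ∈ dualCode N := fun v hv => by
    rw [hfw]; exact hle (Submodule.mem_map_of_mem hv)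
  have hw0 : w ≠ 0 := by
    rintro h0
    refine hf (LinearMap.pi_ext' fun i => LinearMap.ext_ring ?_)
    have := congrFun h0 i.1
    simpa [w] using this
  exact absurd (hN w hw hw0) (not_le.2 ((hammingNorm_le_card fun i hi => by simp [w, hi]).trans_lt hT))

-- The diagonal entries depend only on the coordinates in `T`, on which `N` takes all values. So the
-- sum does not depend on the coset and equals its average over all translates.
open Classical in
theorem sum_diag_cosetState {N : Submodule F (ι → F)} {d : ℕ}
    (hN : ∀ w ∈ dualCode N, w ≠ 0 → d ≤ hammingNorm w) {T : Finset ι} (hT : T.card < d)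
    {E : ι → Matrix F F ℂ} (hE : ∀ i ∉ T, E i = 1) (a : ι → F) :
    (∑ x, if x - a ∈ N then tensorMatrix E x x else 0) =
      Fintype.card N * (tensorMatrix E).trace / (Fintype.card F : ℂ) ^ Fintype.card ι := by
  set S : (ι → F) → ℂ := fun a => ∑ x, if x - a ∈ N then tensorMatrix E x x else 0 with hS
  have hconst (z : ι → F) : S z = S a := by
    obtain ⟨v, hv, hvz⟩ := exists_mem_eqOn hN hT (z - a)
    have h1 : S z = ∑ x, if x - a ∈ N then tensorMatrix E (x + (z - a)) (x + (z - a)) else 0 := by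
      rw [hS]
      refine (Fintype.sum_equiv (Equiv.addRight (z - a)) _ _ fun x => ?_).symm
      rw [Equiv.coe_addRight, show x + (z - a) - z = x - a by abel]
    have h2 : S a = ∑ x, if x - a ∈ N then tensorMatrix E (x + v) (x + v) else 0 := by
      rw [hS]
      refine (Fintype.sum_equiv (Equiv.addRight v) _ _ fun x => ?_).symm
      have : x + v - a ∈ N ↔ x - a ∈ N := by
        rw [add_sub_right_comm]; exact N.add_mem_iff_left hv
      simp [this]
    rw [h1, h2]
    refine Finset.sum_congr rfl fun x _ => ?_
    rw [tensorMatrix_diag_congr hE (x := x + (z - a)) (y := x + v)]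
    intro i hi
    simp [hvz i hi]
  -- Each `x` lies in `z + N` for exactly `|N|` choices of `z`.
  have hsum : ∑ z, S z = Fintype.card N * (tensorMatrix E).trace := by
    rw [hS, Finset.sum_comm, Matrix.trace, Finset.mul_sum]
    refine Finset.sum_congr rfl fun x _ => ?_
    rw [Fintype.sum_equiv (Equiv.subLeft x) _ (fun y => if y ∈ N then tensorMatrix E x x else 0)
      fun y => by simp]
    rw [← Finset.sum_filter, Finset.sum_const, nsmul_eq_mul, Fintype.card_subtype]
    rfl
  have hq : (Fintype.card F : ℂ) ^ Fintype.card ι ≠ 0 :=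
    pow_ne_zero _ (Nat.cast_ne_zero.2 Fintype.card_ne_zero)
  rw [eq_div_iff hq, ← hsum, Finset.sum_congr rfl fun z _ => hconst z, Finset.sum_const,
    nsmul_eq_mul, Finset.card_univ, Fintype.card_fun, mul_comm]
  push_cast
  rfl

-- Two distinct words of one coset differ in at least `d` positions, hence somewhere outside `T`,
-- where `E` is the identity; only the diagonal sum remains.
open Classical in
theorem inner_cosetState_self {N : Submodule F (ι → F)} {d : ℕ}
    (hN : ∀ v ∈ N, v ≠ 0 → d ≤ hammingNorm v)
    (hN' : ∀ w ∈ dualCode N, w ≠ 0 → d ≤ hammingNorm w) {T : Finset ι} (hT : T.card < d)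
    {E : ι → Matrix F F ℂ} (hE : ∀ i ∉ T, E i = 1) (a : ι → F) :
    inner ℂ (cosetState N a) (tensorOp E (cosetState N a)) =
      Fintype.card N * (tensorMatrix E).trace / (Fintype.card F : ℂ) ^ Fintype.card ι := by
  rw [← sum_diag_cosetState hN' hT hE a, inner_cosetState]
  refine Finset.sum_congr rfl fun x _ => ?_
  rw [Finset.sum_eq_single x]
  · simp
  · intro y _ hyx
    refine ite_eq_right_iff.2 fun h => ?_
    by_contra hne
    have hmem : y - x ∈ N := by simpa using N.sub_mem h.2 h.1
    refine absurd (hN _ hmem (sub_ne_zero.2 hyx)) (not_le.2 ((hammingNorm_le_card ?_).trans_lt hT))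
    intro i hi
    by_contra h0
    exact hne (tensorMatrix_apply_eq_zero hE hi fun h => h0 (by simp [h]))
  · simp

theorem inner_cosetState_of_far {N : Submodule F (ι → F)} {d : ℕ} {a b : ι → F}
    (hab : ∀ v ∈ N, d ≤ hammingNorm (a - b + v)) {T : Finset ι} (hT : T.card < d)
    {E : ι → Matrix F F ℂ} (hE : ∀ i ∉ T, E i = 1) :
    inner ℂ (cosetState N a) (tensorOp E (cosetState N b)) = 0 := by
  classical
  rw [inner_cosetState]
  refine Finset.sum_eq_zero fun x _ => Finset.sum_eq_zero fun y _ => ite_eq_right_iff.2 fun h => ?_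
  by_contra hne
  have := hab _ (N.sub_mem h.1 h.2)
  rw [show a - b + (x - a - (y - b)) = x - y by abel] at this
  refine absurd this (not_le.2 ((hammingNorm_le_card fun i hi => ?_).trans_lt hT))
  by_contra h0
  exact hne (tensorMatrix_apply_eq_zero hE hi fun h => h0 (by simp [h]))

/-- A span of coset states of `N`. -/
noncomputable def cosetCode {J : Type*} (N : Submodule F (ι → F)) (a : J → ι → F) :
    Submodule ℂ (QuditSpace F ι) :=
  Submodule.span ℂ (Set.range fun j => cosetState N (a j))

section Code

variable {J : Type*} {N : Submodule F (ι → F)} {a : J → ι → F} {d : ℕ}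

/-- The identity is an error with empty support, so the formula for errors also computes the norm.
-/
theorem inner_self_cosetState_ne_zero (hd : 0 < d)
    (hN : ∀ v ∈ N, v ≠ 0 → d ≤ hammingNorm v)
    (hN' : ∀ w ∈ dualCode N, w ≠ 0 → d ≤ hammingNorm w) (b : ι → F) :
    inner ℂ (cosetState N b) (cosetState N b) ≠ 0 := by
  classical
  have h := inner_cosetState_self hN hN' (T := ∅) (by simpa using hd)
    (E := fun _ => 1) (fun _ _ => rfl) b
  rw [tensorOp_one] at h
  rw [h, tensorMatrix_one, Matrix.trace_one]
  have h1 : (Fintype.card N : ℂ) ≠ 0 := Nat.cast_ne_zero.2 Fintype.card_ne_zero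
  have h2 : (Fintype.card F : ℂ) ≠ 0 := Nat.cast_ne_zero.2 Fintype.card_ne_zero
  simp [h1, h2]

theorem inner_cosetState_eq_zero (hd : 0 < d) {b c : ι → F}
    (hbc : ∀ v ∈ N, d ≤ hammingNorm (b - c + v)) :
    inner ℂ (cosetState N b) (cosetState N c) = 0 := by
  have h := inner_cosetState_of_far hbc (T := ∅) (by simpa using hd)
    (E := fun _ => 1) (fun _ _ => rfl)
  rwa [tensorOp_one] at h

theorem finrank_cosetCode [Fintype J] (hd : 0 < d)
    (hN : ∀ v ∈ N, v ≠ 0 → d ≤ hammingNorm v)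
    (hN' : ∀ w ∈ dualCode N, w ≠ 0 → d ≤ hammingNorm w)
    (ha : ∀ j l, j ≠ l → ∀ v ∈ N, d ≤ hammingNorm (a j - a l + v)) :
    Module.finrank ℂ (cosetCode N a) = Fintype.card J := by
  refine finrank_span_eq_card (linearIndependent_of_ne_zero_of_inner_eq_zero (𝕜 := ℂ)
    (fun j h => ?_) fun j l hjl => inner_cosetState_eq_zero hd (ha j l hjl))
  exact inner_self_cosetState_ne_zero hd hN hN' (a j) (by rw [h, inner_zero_left])

/-- Both sides are sesquilinear, so coset states suffice: the off-diagonal terms vanish, and the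
diagonal ones give the same scalar for every coset. -/
theorem pureForError_cosetCode
    (hN : ∀ v ∈ N, v ≠ 0 → d ≤ hammingNorm v)
    (hN' : ∀ w ∈ dualCode N, w ≠ 0 → d ≤ hammingNorm w)
    (ha : ∀ j l, j ≠ l → ∀ v ∈ N, d ≤ hammingNorm (a j - a l + v)) {T : Finset ι}
    (hT : T.card < d) {E : ι → Matrix F F ℂ} (hE : ∀ i ∉ T, E i = 1) :
    PureForError (cosetCode N a) E := by
  classical
  have hd : 0 < d := by omega
  intro x hx y hy
  induction hx using Submodule.span_induction with
  | zero => simp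
  | add x x' _ _ h h' => rw [inner_add_left, inner_add_left, h, h', mul_add]
  | smul c x _ h => rw [inner_smul_left, inner_smul_left, h]; ring
  | mem x hx =>
    obtain ⟨j, rfl⟩ := hx
    induction hy using Submodule.span_induction with
    | zero => simp
    | add y y' _ _ h h' => rw [map_add, inner_add_right, inner_add_right, h, h', mul_add]
    | smul c y _ h => rw [map_smul, inner_smul_right, inner_smul_right, h]; ring
    | mem y hy =>
      obtain ⟨l, rfl⟩ := hy
      dsimp only
      by_cases hjl : j = l
      · subst hjl
        have h1 := inner_cosetState_self hN hN' (T := ∅) (by simpa using hd)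
          (E := fun _ => 1) (fun _ _ => rfl) (a j)
        have h2 : (Fintype.card F : ℂ) ≠ 0 := Nat.cast_ne_zero.2 Fintype.card_ne_zero
        rw [tensorOp_one, tensorMatrix_one, Matrix.trace_one, Fintype.card_fun] at h1
        rw [inner_cosetState_self hN hN' hT hE, h1]
        push_cast
        field_simp
      · rw [inner_cosetState_of_far (ha j l hjl) hT hE, inner_cosetState_eq_zero hd (ha j l hjl),
          mul_zero]

theorem quantumDistanceAtLeast_cosetCode
    (hN : ∀ v ∈ N, v ≠ 0 → d ≤ hammingNorm v)
    (hN' : ∀ w ∈ dualCode N, w ≠ 0 → d ≤ hammingNorm w)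
    (ha : ∀ j l, j ≠ l → ∀ v ∈ N, d ≤ hammingNorm (a j - a l + v)) :
    QuantumDistanceAtLeast (cosetCode N a) d := fun _ hT _ hE =>
  have h := pureForError_cosetCode hN hN' ha hT hE
  ⟨⟨_, h⟩, fun _ => h⟩

theorem cosetState_mem_cosetCode (j : J) : cosetState N (a j) ∈ cosetCode N a :=
  Submodule.subset_span ⟨j, rfl⟩

end Code

/-! ### Phase errors and upper bounds on the distance. -/

/-- The phase error `|x⟩ ↦ ψ (w ⬝ᵥ x) |x⟩` as a family of one-qudit operators. -/
noncomputable def phaseError (ψ : AddChar F ℂ) (w : ι → F) : ι → Matrix F F ℂ :=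
  fun i => Matrix.diagonal fun z => ψ (w i * z)

theorem AddChar.map_finset_sum (ψ : AddChar F ℂ) (f : ι → F) : ψ (∑ i, f i) = ∏ i, ψ (f i) :=
  map_prod ψ.toMonoidHom (fun i => Multiplicative.ofAdd (f i)) Finset.univ

theorem tensorMatrix_phaseError (ψ : AddChar F ℂ) (w : ι → F) :
    tensorMatrix (phaseError ψ w) = Matrix.diagonal fun x => ψ (w ⬝ᵥ x) := by
  ext x y
  by_cases h : x = y
  · subst h
    simp [tensorMatrix, phaseError, dotProduct, AddChar.map_finset_sum]
  · obtain ⟨i, hi⟩ := Function.ne_iff.1 h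
    rw [Matrix.diagonal_apply_ne _ h]
    exact Finset.prod_eq_zero (Finset.mem_univ i) (Matrix.diagonal_apply_ne _ hi)

theorem phaseError_eq_one (ψ : AddChar F ℂ) {w : ι → F} {i : ι} (h : w i = 0) :
    phaseError ψ w i = 1 := by
  simp [phaseError, h]

/-- The character `x ↦ ψ (w ⬝ᵥ x)` is constant on `a + N` because `w` is orthogonal to `N`. -/
theorem tensorOp_phaseError_cosetState (ψ : AddChar F ℂ) {N : Submodule F (ι → F)} {w : ι → F}
    (hw : w ∈ dualCode N) (a : ι → F) :
    tensorOp (phaseError ψ w) (cosetState N a) = ψ (w ⬝ᵥ a) • cosetState N a := by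
  classical
  ext x
  simp only [tensorOp, Matrix.toLpLin_apply, tensorMatrix_phaseError, Matrix.mulVec_diagonal,
    cosetState, PiLp.smul_apply, smul_eq_mul]
  by_cases hx : x - a ∈ N
  · have := hw _ hx
    rw [sub_dotProduct, sub_eq_zero, dotProduct_comm, dotProduct_comm a] at this
    simp [hx, this]
  · simp [hx]

/-- Translation by `x` multiplies the character sum by a factor other than one. -/
theorem trace_phaseError_eq_zero (ψ : AddChar F ℂ) {w x : ι → F} (h : ψ (w ⬝ᵥ x) ≠ 1) :
    (tensorMatrix (phaseError ψ w)).trace = 0 := by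
  rw [tensorMatrix_phaseError, Matrix.trace_diagonal]
  have h1 : (∑ y : ι → F, ψ (w ⬝ᵥ y)) = ψ (w ⬝ᵥ x) * ∑ y : ι → F, ψ (w ⬝ᵥ y) := by
    rw [Finset.mul_sum]
    refine (Fintype.sum_equiv (Equiv.addLeft x) _ _ fun y => ?_).symm
    simp [dotProduct_add, AddChar.map_add_eq_mul]
  by_contra h0
  exact h (mul_right_cancel₀ h0 (by rw [one_mul]; exact h1.symm))

theorem exists_addChar_ne_one {z : F} (hz : z ≠ 0) : ∃ ψ : AddChar F ℂ, ψ z ≠ 1 :=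
  AddChar.exists_apply_ne_zero.2 hz

/-- A phase error of weight `d` that separates two basis states bounds the distance by `d`. -/
theorem le_of_quantumDistanceAtLeast_cosetCode {J : Type*} {N : Submodule F (ι → F)}
    {a : J → ι → F} {w : ι → F} (hw : w ∈ dualCode N) {j l : J}
    (hne : ∀ j, inner ℂ (cosetState N (a j)) (cosetState N (a j)) ≠ 0)
    (hjl : w ⬝ᵥ (a j - a l) ≠ 0) {δ : ℕ} (hδ : QuantumDistanceAtLeast (cosetCode N a) δ) :
    δ ≤ hammingNorm w := by
  by_contra! hlt
  obtain ⟨ψ, hψ⟩ := exists_addChar_ne_one hjl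
  obtain ⟨⟨c, hc⟩, -⟩ := hδ {i | w i ≠ 0} hlt (phaseError ψ w)
    fun i hi => phaseError_eq_one ψ (by simpa using hi)
  have key (m : J) : ψ (w ⬝ᵥ a m) = c := by
    have := hc _ (cosetState_mem_cosetCode m) _ (cosetState_mem_cosetCode m)
    rw [tensorOp_phaseError_cosetState ψ hw, inner_smul_right] at this
    exact mul_right_cancel₀ (hne m) this
  apply hψ
  rw [dotProduct_sub, AddChar.map_sub_eq_div, key, key, ← key j,
    div_self (ψ.val_isUnit _).ne_zero]

/-- The phase error has trace zero but acts on the coset state as a nonzero scalar, so purity fails.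
-/
theorem le_of_quantumDistanceAtLeast_of_finrank_eq_one {J : Type*} {N : Submodule F (ι → F)}
    {a : J → ι → F} {w : ι → F} (hw : w ∈ dualCode N) (hw0 : w ≠ 0) (j : J)
    (hne : inner ℂ (cosetState N (a j)) (cosetState N (a j)) ≠ 0)
    (h1 : Module.finrank ℂ (cosetCode N a) = 1)
    {δ : ℕ} (hδ : QuantumDistanceAtLeast (cosetCode N a) δ) :
    δ ≤ hammingNorm w := by
  by_contra! hlt
  obtain ⟨i, hi⟩ := Function.ne_iff.1 hw0
  obtain ⟨ψ, hψ⟩ := exists_addChar_ne_one hi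
  have hp := (hδ {i | w i ≠ 0} hlt (phaseError ψ w)
    fun i hi => phaseError_eq_one ψ (by simpa using hi)).2 h1 _ (cosetState_mem_cosetCode j) _
      (cosetState_mem_cosetCode j)
  rw [trace_phaseError_eq_zero ψ (x := Pi.single i 1) (by simpa using hψ),
    tensorOp_phaseError_cosetState ψ hw, inner_smul_right, zero_div, zero_mul] at hp
  exact mul_ne_zero (ψ.val_isUnit _).ne_zero hne hp

end CosetStates

/-! ### Euclidean duality over a field. -/

section Duality

variable {F ι : Type*} [Field F] [Fintype ι]

theorem dualCode_eq_orthogonal (C : Submodule F (ι → F)) :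
    dualCode C = LinearMap.BilinForm.orthogonal (dotProductBilin F F) C := rfl

theorem dotProductBilin_nondegenerate :
    LinearMap.BilinForm.Nondegenerate (dotProductBilin F F : LinearMap.BilinForm F (ι → F)) := by
  refine ⟨fun v hv => dotProduct_eq_zero v hv, fun v hv => dotProduct_eq_zero v fun w => ?_⟩
  rw [dotProduct_comm]
  exact hv w

theorem finrank_dualCode (C : Submodule F (ι → F)) :
    Module.finrank F (dualCode C) = Fintype.card ι - Module.finrank F C := by
  rw [dualCode_eq_orthogonal, LinearMap.BilinForm.finrank_orthogonal dotProductBilin_nondegenerate,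
    Module.finrank_fintype_fun_eq_card]

theorem dualCode_dualCode (C : Submodule F (ι → F)) : dualCode (dualCode C) = C := by
  rw [dualCode_eq_orthogonal, dualCode_eq_orthogonal]
  refine LinearMap.BilinForm.orthogonal_orthogonal dotProductBilin_nondegenerate
    (fun x y h => ?_) C
  change y ⬝ᵥ x = 0
  rw [dotProduct_comm]
  exact h

theorem card_le_two_mul_finrank {C : Submodule F (ι → F)} (h : dualCode C ≤ C) :
    Fintype.card ι ≤ 2 * Module.finrank F C := by
  have := Submodule.finrank_mono h
  rw [finrank_dualCode] at this
  omega

end Duality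

/-! ### Minimum distance as minimum weight. -/

section Distance

variable {F ι : Type*} [Field F] [DecidableEq F] [Fintype ι]

theorem codeDistance_le_hammingNorm {C : Submodule F (ι → F)} {w : ι → F} (hw : w ∈ C)
    (hw0 : w ≠ 0) : codeDistance (C : Set (ι → F)) ≤ hammingNorm w :=
  Nat.sInf_le ⟨w, hw, 0, C.zero_mem, hw0, hammingDist_zero_right w⟩

theorem exists_hammingNorm_eq_codeDistance {C : Submodule F (ι → F)} (hC : C ≠ ⊥) :
    ∃ w ∈ C, w ≠ 0 ∧ hammingNorm w = codeDistance (C : Set (ι → F)) := by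
  obtain ⟨z, hz, hz0⟩ := C.exists_mem_ne_zero_of_ne_bot hC
  obtain ⟨x, hx, y, hy, hxy, h⟩ := Nat.sInf_mem
    (s := {d | ∃ x ∈ (C : Set (ι → F)), ∃ y ∈ (C : Set (ι → F)), x ≠ y ∧ hammingDist x y = d})
    ⟨_, z, hz, 0, C.zero_mem, hz0, rfl⟩
  refine ⟨-x + y, C.add_mem (C.neg_mem hx) hy, fun h => hxy (neg_add_eq_zero.1 h), ?_⟩
  rw [← hammingDist_eq_hammingNorm, h]
  rfl

theorem hammingNorm_sub_single_le [DecidableEq ι] (x : ι → F) (i : ι) (c : F) :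
    hammingNorm x ≤ hammingNorm (x - Pi.single i c) + 1 := by
  have h1 := hammingDist_triangle x (Pi.single i c) 0
  rw [hammingDist_zero_right, hammingDist_zero_right, hammingDist_comm x,
    hammingDist_eq_hammingNorm, neg_add_eq_sub] at h1
  have h2 : hammingNorm (Pi.single i c : ι → F) ≤ ({i} : Finset ι).card :=
    Finset.card_le_card fun j hj => by
      by_contra hji
      exact (Finset.mem_filter.1 hj).2 (Pi.single_eq_of_ne (M := fun _ => F) (by simpa using hji) c)
  rw [Finset.card_singleton] at h2
  omega

end Distance

/-! ### The quantum code with the exact distance. -/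

section Existence

variable {F ι : Type*} [Field F] [Fintype F] [DecidableEq F] [Fintype ι] [DecidableEq ι]

/-- A linear code `C` of length `n` that contains its dual yields a quantum code with parameters
`[[n, 2 dim C - n, d]]`, where `d` is the Hamming distance of `C`. -/
theorem exists_isQuantumCode_of_dualCode_le [Nonempty ι] {C : Submodule F (ι → F)}
    (hC : dualCode C ≤ C) :
    ∃ Q : Submodule ℂ (QuditSpace F ι), IsQuantumCode Q (Fintype.card ι)
      (2 * Module.finrank F C - Fintype.card ι) (codeDistance (C : Set (ι → F))) := by
  classical
  set N := dualCode C with hNdef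
  set d := codeDistance (C : Set (ι → F)) with hd
  have hNC : dualCode N = C := dualCode_dualCode C
  have hcard := card_le_two_mul_finrank hC
  have hι : 0 < Fintype.card ι := Fintype.card_pos
  -- The zero code must be excluded: its `codeDistance` is the default value `sInf ∅ = 0`.
  have hbot : C ≠ ⊥ := by
    rintro rfl
    rw [finrank_bot] at hcard
    omega
  obtain ⟨w, hw, hw0, hwd⟩ := exists_hammingNorm_eq_codeDistance hbot
  have hdpos : 0 < d := by rw [hd, ← hwd]; exact hammingNorm_pos_iff.2 hw0
  have hCd : ∀ x ∈ C, x ≠ 0 → d ≤ hammingNorm x := fun x hx hx0 =>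
    codeDistance_le_hammingNorm hx hx0
  have hN : ∀ v ∈ N, v ≠ 0 → d ≤ hammingNorm v := fun v hv => hCd v (hC hv)
  have hN' : ∀ v ∈ dualCode N, v ≠ 0 → d ≤ hammingNorm v := by rwa [hNC]
  have hwN : w ∈ dualCode N := hNC.symm ▸ hw
  let J := C ⧸ N.comap C.subtype
  have : Fintype J := Fintype.ofFinite J
  have hJ : Fintype.card J = Fintype.card F ^ (2 * Module.finrank F C - Fintype.card ι) := by
    rw [Module.card_eq_pow_finrank (K := F)]
    congr 1
    have h1 := (N.comap C.subtype).finrank_quotient_add_finrank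
    have h2 : Module.finrank F (N.comap C.subtype) = Module.finrank F N :=
      (Submodule.comapSubtypeEquivOfLe hC).finrank_eq
    have h3 := finrank_dualCode C
    have h4 := Submodule.finrank_le C
    rw [Module.finrank_fintype_fun_eq_card] at h4
    rw [← hNdef] at h3
    change Module.finrank F J + _ = _ at h1
    omega
  let b : J → ι → F := fun j => (Quotient.out j : C)
  have hbC (j : J) : b j ∈ C := (Quotient.out j : C).2
  have hbN {j l : J} (h : b j - b l ∈ N) : j = l := by
    have hj : (Submodule.Quotient.mk (Quotient.out j : C) : J) = j := Quotient.out_eq' j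
    have hl : (Submodule.Quotient.mk (Quotient.out l : C) : J) = l := Quotient.out_eq' l
    rw [← hj, ← hl, Submodule.Quotient.eq]
    exact h
  have hbsurj {x : ι → F} (hx : x ∈ C) : ∃ j, b j - x ∈ N := by
    refine ⟨Submodule.Quotient.mk ⟨x, hx⟩, ?_⟩
    exact (Submodule.Quotient.eq (N.comap C.subtype)).1
      (Quotient.out_eq' (Submodule.Quotient.mk ⟨x, hx⟩ : J))
  have hbmem {j l : J} (hjl : j ≠ l) {v : ι → F} (hv : v ∈ N) :
      b j - b l + v ∈ C ∧ b j - b l + v ∉ N :=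
    ⟨C.add_mem (C.sub_mem (hbC j) (hbC l)) (hC hv),
      fun h => hjl (hbN ((N.add_mem_iff_left hv).1 h))⟩
  have hmain (a : J → ι → F)
      (ha : ∀ j l, j ≠ l → ∀ v ∈ N, d ≤ hammingNorm (a j - a l + v))
      (hub : ∀ δ, QuantumDistanceAtLeast (cosetCode N a) δ → δ ≤ hammingNorm w) :
      ∃ Q : Submodule ℂ (QuditSpace F ι), IsQuantumCode Q (Fintype.card ι)
        (2 * Module.finrank F C - Fintype.card ι) d :=
    ⟨cosetCode N a, rfl, by rw [finrank_cosetCode hdpos hN hN' ha, hJ],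
      quantumDistanceAtLeast_cosetCode hN hN' ha, fun δ hδ => (hub δ hδ).trans_eq hwd⟩
  have hne := inner_self_cosetState_ne_zero hdpos hN hN'
  have hb : ∀ j l, j ≠ l → ∀ v ∈ N, d ≤ hammingNorm (b j - b l + v) := fun j l hjl v hv =>
    hCd _ (hbmem hjl hv).1 fun h => (hbmem hjl hv).2 (h ▸ N.zero_mem)
  -- Here `C = N` and the code is one-dimensional, so the bound comes from the purity convention.
  by_cases hsub : Subsingleton J
  · refine hmain b hb fun δ hδ => ?_
    refine le_of_quantumDistanceAtLeast_of_finrank_eq_one hwN hw0 0 (hne _) ?_ hδ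
    rw [finrank_cosetCode hdpos hN hN' hb]
    exact Fintype.card_eq_one_iff.2 ⟨0, fun j => Subsingleton.elim _ _⟩
  rw [not_subsingleton_iff_nontrivial] at hsub
  -- If a lightest word lies outside `N`, the ordinary CSS code works: some `x` in `C` pairs
  -- nontrivially with `z`, and the phase error of `z` separates the cosets of `x` and `0`.
  by_cases hex : ∃ z ∈ C, z ∉ N ∧ hammingNorm z = d
  · obtain ⟨z, hz, hzN, hzd⟩ := hex
    have hzC : ¬ ∀ x ∈ C, x ⬝ᵥ z = 0 := hzN
    push Not at hzC
    obtain ⟨x, hx, hxz⟩ := hzC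
    obtain ⟨j, hj⟩ := hbsurj hx
    obtain ⟨l, hl⟩ := hbsurj C.zero_mem
    refine hmain b hb fun δ hδ => ?_
    have hz' : z ∈ dualCode N := hNC.symm ▸ hz
    rw [hwd, ← hd, ← hzd]
    refine le_of_quantumDistanceAtLeast_cosetCode hz' (j := j) (l := l) (fun _ => hne _) ?_ hδ
    have h1 := hz' _ (N.sub_mem hj hl)
    rw [show b j - x - (b l - 0) = b j - b l - x by abel, sub_dotProduct, sub_eq_zero] at h1
    rwa [dotProduct_comm, h1]
  · push Not at hex
    have hwN' : w ∈ N := by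
      by_contra h
      exact hex w hw h hwd
    -- No word of `C` outside `N` has weight `d`, so distinct cosets are `d + 1` apart; this leaves
    -- room for a shift of weight one.
    have hb1 {j l : J} (hjl : j ≠ l) {v : ι → F} (hv : v ∈ N) :
        d + 1 ≤ hammingNorm (b j - b l + v) :=
      lt_of_le_of_ne (hb j l hjl v hv) fun h =>
        hex _ (hbmem hjl hv).1 (hbmem hjl hv).2 h.symm
    obtain ⟨i, hi⟩ := Function.ne_iff.1 hw0
    obtain ⟨m, hm⟩ := exists_ne (0 : J)
    -- One basis state is shifted by a word of weight one in the support of `w`.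
    let a : J → ι → F := Function.update b 0 (b 0 + Pi.single i 1)
    have ha0 : a 0 = b 0 + Pi.single i 1 := Function.update_self _ _ _
    have ha1 {j : J} (hj : j ≠ 0) : a j = b j := Function.update_of_ne hj _ _
    refine hmain a (fun j l hjl v hv => ?_) fun δ hδ => ?_
    · by_cases hj : j = 0
      · subst hj
        rw [ha0, ha1 hjl.symm]
        have h1 := hb1 hjl hv
        have h2 := hammingNorm_sub_single_le (b 0 - b l + v) i (-1)
        rw [Pi.single_neg, sub_neg_eq_add] at h2
        rw [show b 0 + Pi.single i 1 - b l + v = b 0 - b l + v + Pi.single i 1 by abel]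
        omega
      · by_cases hl : l = 0
        · subst hl
          rw [ha0, ha1 hj]
          have h1 := hb1 hjl hv
          have h2 := hammingNorm_sub_single_le (b j - b 0 + v) i 1
          rw [show b j - (b 0 + Pi.single i 1) + v = b j - b 0 + v - Pi.single i 1 by abel]
          omega
        · rw [ha1 hj, ha1 hl]
          exact hb j l hjl v hv
    · refine le_of_quantumDistanceAtLeast_cosetCode hwN (j := 0) (l := m) (fun _ => hne _) ?_ hδ
      -- The unshifted representatives are invisible to `w`, so the pairing reduces to `w i`, which
      -- is nonzero.
      have h1 : w ⬝ᵥ (b 0 - b m) = 0 := by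
        rw [dotProduct_comm]
        exact hwN' _ (C.sub_mem (hbC 0) (hbC m))
      rw [ha0, ha1 hm, add_sub_right_comm, dotProduct_add, h1, zero_add, dotProduct_single_one]
      exact hi

end Existence

/-! ### The Gray map and duality. -/

section Gray

variable {F : Type*} [Field F]

theorem grayMatrix_mul_transpose (h2 : (2 : F) ≠ 0) :
    grayMatrix F * (grayMatrix F)ᵀ = 1 := by
  ext i j
  fin_cases i <;> fin_cases j <;>
    simp [grayMatrix, Matrix.mul_apply, Fin.sum_univ_four] <;> field_simp <;> norm_num

theorem vecMul_grayMatrix_dotProduct (h2 : (2 : F) ≠ 0) (x y : Fin 4 → F) :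
    (x ᵥ* grayMatrix F) ⬝ᵥ (y ᵥ* grayMatrix F) = x ⬝ᵥ y := by
  rw [← Matrix.mulVec_transpose (grayMatrix F) y, Matrix.dotProduct_mulVec, Matrix.vecMul_vecMul,
    grayMatrix_mul_transpose h2, Matrix.vecMul_one]

namespace UVRing

theorem components_mul (x y : UVRing F) : components (x * y) = components x * components y := by
  ext i; fin_cases i <;> simp [components] <;> ring

theorem components_add (x y : UVRing F) : components (x + y) = components x + components y := by
  ext i; fin_cases i <;> simp [components] <;> ring

/-- The element of `R` with given components. -/
def ofComponents (n : Fin 4 → F) : UVRing F :=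
  ⟨n 0, n 1 - n 0, n 2 - n 0, n 3 - n 1 - n 2 + n 0⟩

theorem components_ofComponents (n : Fin 4 → F) : components (ofComponents n) = n := by
  ext i; fin_cases i <;> simp [components, ofComponents]
  ring

theorem components_injective : Function.Injective (components (F := F)) := fun x y h => by
  have h0 := congrFun h 0
  have h1 := congrFun h 1
  have h2 := congrFun h 2
  have h3 := congrFun h 3
  simp only [components, Matrix.cons_val] at h0 h1 h2 h3
  ext
  · exact h0
  · linear_combination h1 - h0
  · linear_combination h2 - h0
  · linear_combination h3 - h1 - h2 + h0

theorem components_dotProduct {s : ℕ} (x y : Fin s → UVRing F) (i : Fin 4) :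
    components (x ⬝ᵥ y) i = ∑ j, components (x j) i * components (y j) i := by
  let f : UVRing F →+ F :=
    { toFun := fun z => components z i
      map_zero' := by fin_cases i <;> simp [components]
      map_add' := fun x y => congrFun (components_add x y) i }
  change f (∑ j, x j * y j) = _
  rw [map_sum]
  exact Finset.sum_congr rfl fun j _ => congrFun (components_mul _ _) i

end UVRing

open UVRing

variable {r s : ℕ}

/-- The position `4 j + i` in the Gray image of the `i`-th entry of the `j`-th block. -/
def blockEquiv (s : ℕ) : Fin s × Fin 4 ≃ Fin (4 * s) :=
  finProdFinEquiv.trans (finCongr (Nat.mul_comm s 4))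

theorem grayMap_apply (d : (Fin r → F) × (Fin s → UVRing F)) :
    grayMap F r s d = Fin.append d.1 fun j : Fin (4 * s) =>
      (components (d.2 ⟨j / 4, by omega⟩) ᵥ* grayMatrix F) ⟨j % 4, by omega⟩ :=
  rfl

theorem grayMap_castAdd (d : (Fin r → F) × (Fin s → UVRing F)) (i : Fin r) :
    grayMap F r s d (Fin.castAdd _ i) = d.1 i := by
  rw [grayMap_apply, Fin.append_left]

theorem grayMap_natAdd (d : (Fin r → F) × (Fin s → UVRing F)) (p : Fin s × Fin 4) :
    grayMap F r s d (Fin.natAdd r (blockEquiv s p)) =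
      (components (d.2 p.1) ᵥ* grayMatrix F) p.2 := by
  rw [grayMap_apply, Fin.append_right]
  have h1 : ((blockEquiv s p : Fin (4 * s)) : ℕ) = p.2 + 4 * p.1 := rfl
  have h3 (h) : (⟨(blockEquiv s p : Fin (4 * s)) / 4, h⟩ : Fin s) = p.1 :=
    Fin.ext (by simp only [h1]; omega)
  have h4 (h) : (⟨(blockEquiv s p : Fin (4 * s)) % 4, h⟩ : Fin 4) = p.2 :=
    Fin.ext (by simp only [h1]; omega)
  rw [h3, h4]

theorem grayMap_dotProduct (h2 : (2 : F) ≠ 0) (d e : (Fin r → F) × (Fin s → UVRing F)) :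
    grayMap F r s d ⬝ᵥ grayMap F r s e =
      d.1 ⬝ᵥ e.1 + ∑ j, components (d.2 j) ⬝ᵥ components (e.2 j) := by
  simp only [← vecMul_grayMatrix_dotProduct h2 (components _)]
  simp only [dotProduct]
  rw [Fin.sum_univ_add, ← (blockEquiv s).sum_comp, Fintype.sum_prod_type]
  simp only [grayMap_castAdd, grayMap_natAdd]

theorem grayMap_surjective (h2 : (2 : F) ≠ 0) : Function.Surjective (grayMap F r s) := by
  intro y
  refine ⟨(fun i => y (Fin.castAdd _ i), fun j => ofComponents
    ((fun i => y (Fin.natAdd r (blockEquiv s (j, i)))) ᵥ* (grayMatrix F)ᵀ)), funext fun k => ?_⟩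
  induction k using Fin.addCases with
  | left i => rw [grayMap_castAdd]
  | right k =>
    obtain ⟨p, rfl⟩ := (blockEquiv s).surjective k
    rw [grayMap_natAdd, components_ofComponents, Matrix.vecMul_vecMul,
      mul_eq_one_comm.1 (grayMatrix_mul_transpose h2), Matrix.vecMul_one]

/-- By surjectivity a dual word is the image of some `(g, b)`, and by separability it can be tested
on `(x, 0)` and `(0, c)` separately. Orthogonality over `F` only says that the four components of `c
⬝ᵥ b` sum to zero; stability of `C_s` under `R` upgrades this to `c ⬝ᵥ b = 0`. -/
theorem dualCode_grayImage_le (h2 : (2 : F) ≠ 0)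
    {D : Submodule (UVRing F) ((Fin r → F) × (Fin s → UVRing F))} (hsep : IsSeparableCode D)
    (hdr : dualCode (firstCode D) ≤ firstCode D)
    (hds : dualCode (secondCode D) ≤ secondCode D) :
    dualCode (grayImage D) ≤ grayImage D := by
  intro y hy
  obtain ⟨⟨g, b⟩, rfl⟩ := grayMap_surjective h2 y
  have hmem {x : Fin r → F} {c : Fin s → UVRing F} :
      (x, c) ∈ D ↔ x ∈ firstCode D ∧ c ∈ secondCode D :=
    Set.ext_iff.1 hsep (x, c)
  have horth {x : Fin r → F} {c : Fin s → UVRing F} (hx : x ∈ firstCode D)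
      (hc : c ∈ secondCode D) :
      x ⬝ᵥ g + ∑ j, components (c j) ⬝ᵥ components (b j) = 0 := by
    rw [← grayMap_dotProduct h2 (x, c) (g, b)]
    exact hy _ (Submodule.mem_map_of_mem (hmem.2 ⟨hx, hc⟩))
  refine Submodule.mem_map_of_mem (hmem.2 ⟨hdr fun x hx => ?_, hds fun c hc => ?_⟩)
  · simpa [components] using horth hx (secondCode D).zero_mem
  · refine components_injective (funext fun i => ?_)
    -- Multiplying `c` by the `i`-th primitive idempotent of `R` leaves only the `i`-th component of
    -- the pairing.
    have h := horth (firstCode D).zero_mem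
      ((secondCode D).smul_mem (ofComponents (Pi.single i 1)) hc)
    rw [zero_dotProduct, zero_add] at h
    simp only [Pi.smul_apply, smul_eq_mul, components_mul,
      components_ofComponents, dotProduct, Pi.mul_apply, Pi.single_apply, ite_mul, one_mul,
      zero_mul, Finset.sum_ite_eq', Finset.mem_univ, if_true] at h
    rw [components_dotProduct, h]
    fin_cases i <;> simp [components]

end Gray

theorem theorem6p8 {F : Type*} [Field F] [Fintype F] [DecidableEq F]
    (hq : Odd (Fintype.card F)) {r s : ℕ} (hr : 0 < r) (hs : 0 < s) (θ : F ≃+* F)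
    (D : Submodule (UVRing F) ((Fin r → F) × (Fin s → UVRing F)))
    (hcyc : IsSkewCyclic θ D) (hsep : IsSeparableCode D)
    (hdr : dualCode (firstCode D) ≤ firstCode D)
    (hds : dualCode (secondCode D) ≤ secondCode D) :
    r + 4 * s ≤ 2 * Module.finrank F (grayImage D) ∧
      ∃ Q : Submodule ℂ (QuditSpace F (Fin (r + 4 * s))),
        IsQuantumCode Q (r + 4 * s) (2 * Module.finrank F (grayImage D) - (r + 4 * s))
          (codeDistance (grayImage D : Set (Fin (r + 4 * s) → F))) := by
  -- Odd order excludes characteristic two, so the factor `1/2` in `M` is a true inverse.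
  have h2 : (2 : F) ≠ 0 := Ring.two_ne_zero (by
    intro h
    have := FiniteField.even_card_of_char_two h
    rw [Nat.odd_iff] at hq
    omega)
  have hle := dualCode_grayImage_le h2 hsep hdr hds
  have : Nonempty (Fin (r + 4 * s)) := ⟨⟨0, by omega⟩⟩
  have hcard := card_le_two_mul_finrank hle
  have hex := exists_isQuantumCode_of_dualCode_le hle
  rw [Fintype.card_fin] at hcard hex
  exact ⟨hcard, hex⟩
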